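/- Let $\mathbb D$ be the open unit disc in $\mathbb C$. Let $\beta$ be the complex Banach space of all analytic functions $f$ on $\mathbb D$ with $$\|f\|_\beta:=\sup_{z\in\mathbb D}(1-|z|^2)\,|f(z)|<\infty ,$$ normed by $\|\cdot\|_\beta$, and let $\beta_0\subset\beta$ (the little Bloch space) be the subspace of those $f\in\beta$ with $\lim_{|z|\to1}(1-|z|^2)f(z)=0$. For complex Banach spaces $X,Y$ let $\mathcal L(X,Y)$ be the space of bounded linear operators from $X$ to $Y$ with the operator norm, $\mathcal K(X,Y)$ its subspace of compact operators, $\mathcal L(X)=\mathcal L(X,X)$ and $\mathcal K(X)=\mathcal K(X,X)$. A closed subspace $J$ of a Banach space $E$ is called an $M$-ideal in $E$ if there is a subspace $V$ of the dual space $E^*$ such that $E^*=J^\perp\oplus_1 V$, i.e. $E^*$ is the direct sum of $J^\perp=\{f\in E^*: f|_J=0\}$ and $V$, and $\|f+g\|=\|f\|+\|g\|$ for all $f\in J^\perp$, $g\in V$. 1. The space $\beta_0$ embeds almost isometrically into the complex sequence space $c_0$: for every $\varepsilon>0$ there is a closed subspace $X_0$ of $c_0$ with $d(\beta_0,X_0)<1+\varepsilon$,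 where $d(X,Y)=\inf\|T\|\,\|T^{-1}\|$ (the infimum over all surjective isomorphisms $T:X\to Y$) is the Banach–Mazur distance. 2. $\mathcal K(\beta_0)$ is an $M$-ideal in $\mathcal L(\beta_0)$. 3. For every complex Banach space $X$, $\mathcal K(X,\beta_0)$ is an $M$-ideal in $\mathcal L(X,\beta)$, where an operator into $\beta_0$ is regarded as an operator into $\beta$ through the inclusion $\beta_0\subset\beta$. -/

import Mathlib

open Filter Topology
open scoped ENNReal ZeroAtInfty Complex.UnitDisc

noncomputable section

section MIdeals

variable {𝕜 E F : Type*} [RCLike 𝕜] [NormedAddCommGroup E] [NormedSpace 𝕜 E]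
  [NormedAddCommGroup F] [NormedSpace 𝕜 F]

/-- The annihilator `J^⊥` of a subspace `J ⊆ E` in the topological dual `E*`. -/
def dualAnnih (J : Submodule 𝕜 E) : Submodule 𝕜 (StrongDual 𝕜 E) where
  carrier := {f | ∀ x ∈ J, f x = 0}
  add_mem' hf hg x hx := by simp [hf x hx, hg x hx]
  zero_mem' x _ := by simp
  smul_mem' c f hf x hx := by simp [hf x hx]

/-- `J` is an M-ideal in `E`: it is a closed subspace, and `E* = J^⊥ ⊕₁ V` for some subspace `V`
of `E*`, i.e. `E*` is the direct sum of `J^⊥` and `V`, with `‖f + g‖ = ‖f‖ + ‖g‖` for `f ∈ J^⊥`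
and `g ∈ V`. -/
def IsMIdeal (J : Submodule 𝕜 E) : Prop :=
  IsClosed (J : Set E) ∧
    ∃ V : Submodule 𝕜 (StrongDual 𝕜 E), IsCompl (dualAnnih J) V ∧
      ∀ f ∈ dualAnnih J, ∀ g ∈ V, ‖f + g‖ = ‖f‖ + ‖g‖

variable (𝕜 E F) in
/-- The Banach-Mazur distance `inf ‖T‖ ‖T⁻¹‖` over all surjective isomorphisms `T : E → F`;
it is `∞` if there are none. -/
def banachMazurDist : ℝ≥0∞ :=
  ⨅ T : E ≃L[𝕜] F, ENNReal.ofReal (‖(T : E →L[𝕜] F)‖ * ‖(T.symm : F →L[𝕜] E)‖)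

variable (𝕜 E F) in
/-- `E` embeds almost isometrically into `F`: for every `ε > 0` there is a (closed) subspace of `F`
at Banach-Mazur distance less than `1 + ε` from `E`. -/
def EmbedsAlmostIsometrically : Prop :=
  ∀ ε : ℝ, 0 < ε → ∃ F₀ : Submodule 𝕜 F, IsClosed (F₀ : Set F) ∧
    banachMazurDist 𝕜 E F₀ < ENNReal.ofReal (1 + ε)

end MIdeals

/-- `f` is analytic on the open unit disc. -/
def AnalyticOnDisc (f : 𝔻 → ℂ) : Prop :=
  ∃ F : ℂ → ℂ, AnalyticOnNhd ℂ F (Metric.ball 0 1) ∧ ∀ z : 𝔻, f z = F z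

/-- The weighted modulus `(1 - |z|²) |f(z)|`. -/
def blochWeighted (f : 𝔻 → ℂ) (z : 𝔻) : ℝ := (1 - ‖(z : ℂ)‖ ^ 2) * ‖f z‖

lemma one_sub_sq_nonneg (z : 𝔻) : 0 ≤ 1 - ‖(z : ℂ)‖ ^ 2 := by
  linarith [z.sq_norm_lt_one]

lemma blochWeighted_nonneg (f : 𝔻 → ℂ) (z : 𝔻) : 0 ≤ blochWeighted f z :=
  mul_nonneg (one_sub_sq_nonneg z) (norm_nonneg _)

lemma blochWeighted_add_le (f g : 𝔻 → ℂ) (z : 𝔻) :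
    blochWeighted (f + g) z ≤ blochWeighted f z + blochWeighted g z := by
  have h := mul_le_mul_of_nonneg_left (norm_add_le (f z) (g z)) (one_sub_sq_nonneg z)
  simpa only [blochWeighted, Pi.add_apply, mul_add] using h

lemma blochWeighted_smul (c : ℂ) (f : 𝔻 → ℂ) (z : 𝔻) :
    blochWeighted (c • f) z = ‖c‖ * blochWeighted f z := by
  simp only [blochWeighted, Pi.smul_apply, norm_smul]
  ring

/-- The analytic functions on the disc with `sup (1 - |z|²) |f(z)| < ∞`, as a space of functions. -/
def blochSubmodule : Submodule ℂ (𝔻 → ℂ) where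
  carrier := {f | AnalyticOnDisc f ∧ BddAbove (Set.range (blochWeighted f))}
  add_mem' := by
    rintro f g ⟨⟨F, hF, hfF⟩, ⟨A, hA⟩⟩ ⟨⟨G, hG, hgG⟩, ⟨B, hB⟩⟩
    refine ⟨⟨F + G, hF.add hG, fun z => by simp [hfF, hgG]⟩, ⟨A + B, ?_⟩⟩
    rintro _ ⟨z, rfl⟩
    exact (blochWeighted_add_le f g z).trans (add_le_add (hA ⟨z, rfl⟩) (hB ⟨z, rfl⟩))
  zero_mem' :=
    ⟨⟨fun _ => 0, analyticOnNhd_const, fun _ => rfl⟩, ⟨0, by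
      rintro _ ⟨z, rfl⟩
      simp [blochWeighted]⟩⟩
  smul_mem' := by
    rintro c f ⟨⟨F, hF, hfF⟩, ⟨A, hA⟩⟩
    refine ⟨⟨fun z => c * F z, analyticOnNhd_const.mul hF, fun z => by simp [hfF]⟩,
      ⟨‖c‖ * A, ?_⟩⟩
    rintro _ ⟨z, rfl⟩
    rw [blochWeighted_smul]
    exact mul_le_mul_of_nonneg_left (hA ⟨z, rfl⟩) (norm_nonneg c)

/-- The Bloch space `β`. It is a type of its own, so that it carries the Bloch norm and not the
topology of pointwise convergence. -/
def BlochSpace : Type := blochSubmodule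

namespace BlochSpace

instance : AddCommGroup BlochSpace := inferInstanceAs (AddCommGroup blochSubmodule)

instance : Module ℂ BlochSpace := inferInstanceAs (Module ℂ blochSubmodule)

instance : CoeFun BlochSpace (fun _ => 𝔻 → ℂ) := ⟨fun f => f.1⟩

lemma coe_add (f g : BlochSpace) : ⇑(f + g) = ⇑f + ⇑g := rfl

lemma coe_zero : ⇑(0 : BlochSpace) = 0 := rfl

lemma coe_neg (f : BlochSpace) : ⇑(-f) = -⇑f := rfl

lemma coe_smul (c : ℂ) (f : BlochSpace) : ⇑(c • f) = c • ⇑f := rfl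

lemma le_iSup_weighted (f : BlochSpace) (z : 𝔻) :
    blochWeighted f z ≤ ⨆ w : 𝔻, blochWeighted f w :=
  le_ciSup f.2.2 z

instance : NormedAddCommGroup BlochSpace :=
  AddGroupNorm.toNormedAddCommGroup
    { toFun := fun f => ⨆ z : 𝔻, blochWeighted f z
      map_zero' := by simp [coe_zero, blochWeighted]
      add_le' := fun f g => ciSup_le fun z =>
        (blochWeighted_add_le f g z).trans
          (add_le_add (le_iSup_weighted f z) (le_iSup_weighted g z))
      neg' := fun f => by simp [coe_neg, blochWeighted]
      eq_zero_of_map_eq_zero' := fun f hf => by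
        refine Subtype.ext (funext fun z => ?_)
        have h1 : blochWeighted f z ≤ 0 := hf ▸ le_iSup_weighted f z
        have h2 : blochWeighted f z = 0 := le_antisymm h1 (blochWeighted_nonneg _ _)
        have h3 : 1 - ‖(z : ℂ)‖ ^ 2 ≠ 0 := (sub_pos.2 z.sq_norm_lt_one).ne'
        exact norm_eq_zero.1 ((mul_eq_zero.1 h2).resolve_left h3) }

/-- The Bloch norm `‖f‖ = sup (1 - |z|²) |f(z)|`. -/
lemma norm_def (f : BlochSpace) : ‖f‖ = ⨆ z : 𝔻, (1 - ‖(z : ℂ)‖ ^ 2) * ‖f z‖ := rfl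

instance : NormedSpace ℂ BlochSpace where
  norm_smul_le c f := by
    refine ciSup_le fun z => ?_
    rw [coe_smul, blochWeighted_smul]
    exact mul_le_mul_of_nonneg_left (le_iSup_weighted f z) (norm_nonneg c)

end BlochSpace

/-- The little Bloch space `β₀`: the `f ∈ β` with `(1 - |z|²) f(z) → 0` as `|z| → 1`, a subspace
of `β`, with the norm of `β`. -/
def littleBloch : Submodule ℂ BlochSpace where
  carrier := {f | Tendsto (fun z : 𝔻 => ((1 - ‖(z : ℂ)‖ ^ 2 : ℝ) : ℂ) * f z)
    (comap (fun z : 𝔻 => ‖(z : ℂ)‖) (𝓝 1)) (𝓝 0)}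
  add_mem' {f g} hf hg := by
    have h := Tendsto.add hf hg
    simpa only [Set.mem_ofPred_eq, BlochSpace.coe_add, Pi.add_apply, mul_add, add_zero] using h
  zero_mem' := by
    simpa [BlochSpace.coe_zero] using tendsto_const_nhds (x := (0 : ℂ))
  smul_mem' c f hf := by
    have h := Tendsto.const_mul c hf
    simpa only [Set.mem_ofPred_eq, BlochSpace.coe_smul, Pi.smul_apply, smul_eq_mul,
      mul_left_comm c, mul_zero] using h

/-- `K(X, β₀)` as a subspace of `L(X, β)`: the operators `X → β₀ → β`, where the first is compact
and the second is the inclusion. -/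
def compactIntoLittleBloch (X : Type*) [NormedAddCommGroup X] [NormedSpace ℂ X] :
    Submodule ℂ (X →L[ℂ] BlochSpace) :=
  (compactOperator (RingHom.id ℂ) X littleBloch).map
    (ContinuousLinearMap.compL ℂ X littleBloch BlochSpace littleBloch.subtypeL).toLinearMap

end

/-!
The three claims rest on one estimate: on `|z|, |w| ≤ ρ < 1`, a function `f` of the Bloch space
satisfies `|f z - f w| ≤ 4 ‖f‖ |z - w| / (1 - ρ)²` (`BlochSpace.norm_sub_le_of_norm_le`, from
Cauchy's inequality). In other words `(1 - |z|²) |f z|` is Lipschitz in a hyperbolic sense.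

*Embedding into `c₀`.* By this estimate the values of `(1 - |z|²) f z` on a hyperbolically dense,
locally finite sequence of points determine the norm up to a factor close to `1`, and for `f ∈ β₀`
they form a null sequence. The range of the sampling operator is closed since `β₀` is complete.

*M-ideals.* The dilations `D_a f = f (a ·)` are compact from `β` into `β₀`, and `D_a f → f` for
`f ∈ β₀` as `a → 1`. At a point `z`, `D_a f` is negligible in the weighted modulus if `1 - |z|` is
much smaller than `1 - a`, and `g - D_a g` is negligible if `1 - |z|` is much larger. The means
`K n` of `n + 2` dilations with `1 - a` ranging over the powers of `(n + 2)⁻²` therefore satisfy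
`‖K n f + (g - K n g)‖ ≤ (1 + O(1 / n)) max ‖f‖ ‖g‖`
(`BlochSpace.norm_meanDilation_mix_le`): at each point at most one of the `n + 2` terms is not
controlled by one of the two cases, and the trivial bound for that term costs only `O(1 / n)`.

Composition with `K n` transports this inequality to operator spaces. There it gives the
M-ideal decomposition (`IsMIdeal.of_approximate_projections`): for maps `Φ n : E → J` that
satisfy it and converge strongly to the identity on `J`, the functionals `f` with `f ∘ Φ n → f` along an
ultrafilter are a complement of `J^⊥` by the Banach-Alaoglu theorem. For `f ∈ J^⊥` and `g` in the
complement the limit of `(f + g) (Φ n T + (S - Φ n S))` is `g T + f S`, and therefore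
`‖f‖ + ‖g‖ ≤ ‖f + g‖`.
-/

noncomputable section

/-! ### A criterion for M-ideals -/

section Criterion

variable {𝕜 E : Type*} [RCLike 𝕜] [NormedAddCommGroup E] [NormedSpace 𝕜 E]

/-- Rotating `S` and `T` by unimodular scalars makes `f S` and `g T` nonnegative, so that their sum
has norm `‖f S‖ + ‖g T‖`. -/
lemma norm_add_norm_le_of_joint_bound {f g : StrongDual 𝕜 E} {M : ℝ} (hM : 0 ≤ M)
    (h : ∀ S T : E, ‖f S + g T‖ ≤ M * max ‖S‖ ‖T‖) : ‖f‖ + ‖g‖ ≤ M := by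
  have key : ∀ S T : E, ‖S‖ < 1 → ‖T‖ < 1 → ‖f S‖ + ‖g T‖ ≤ M := by
    intro S T hS hT
    obtain ⟨c, hc, hcS⟩ := RCLike.exists_norm_eq_mul_self (f S)
    obtain ⟨d, hd, hdT⟩ := RCLike.exists_norm_eq_mul_self (g T)
    have h1 := h (c • S) (d • T)
    rw [map_smul, map_smul, smul_eq_mul, smul_eq_mul, ← hcS, ← hdT, norm_smul, norm_smul, hc, hd,
      one_mul, one_mul, ← RCLike.ofReal_add, RCLike.norm_ofReal,
      abs_of_nonneg (by positivity)] at h1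
    exact h1.trans (mul_le_of_le_one_right hM (max_le hS.le hT.le))
  by_contra! hlt
  have hδ : 0 < (‖f‖ + ‖g‖ - M) / 2 := by linarith
  obtain ⟨S, hS, hfS⟩ := f.exists_lt_apply_of_lt_opNorm (sub_lt_self ‖f‖ hδ)
  obtain ⟨T, hT, hgT⟩ := g.exists_lt_apply_of_lt_opNorm (sub_lt_self ‖g‖ hδ)
  linarith [key S T hS hT]

/-- A sequence of "almost projections" `Φ n : E → J` with
`‖Φ n a + (b - Φ n b)‖ ≤ (1 + o(1)) max ‖a‖ ‖b‖` makes `J` an M-ideal. The complement of `J^⊥`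
consists of the functionals that are limits of their own compositions with `Φ n` along a fixed
ultrafilter. -/
theorem IsMIdeal.of_approximate_projections {J : Submodule 𝕜 E} (hJ : IsClosed (J : Set E))
    (Φ : ℕ → E →L[𝕜] E) (ε : ℕ → ℝ) (hε0 : ∀ n, 0 ≤ ε n)
    (hε : Tendsto ε atTop (𝓝 0))
    (hmem : ∀ n a, Φ n a ∈ J) (hlim : ∀ a ∈ J, Tendsto (fun n => Φ n a) atTop (𝓝 a))
    (hbound : ∀ n a b, ‖Φ n a + (b - Φ n b)‖ ≤ (1 + ε n) * max ‖a‖ ‖b‖) :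
    IsMIdeal (𝕜 := 𝕜) J := by
  obtain ⟨U, hU⟩ : ∃ U : Ultrafilter ℕ, (U : Filter ℕ) ≤ atTop :=
    ⟨Ultrafilter.of atTop, Ultrafilter.of_le _⟩
  let V : Submodule 𝕜 (StrongDual 𝕜 E) :=
    { carrier := {f | ∀ a, Tendsto (fun n => f (Φ n a)) U (𝓝 (f a))}
      add_mem' := fun hf hg a => by simpa using (hf a).add (hg a)
      zero_mem' := fun a => by simp
      smul_mem' := fun c f hf a => by simpa using (hf a).const_mul c }
  have hεbdd : ∃ C, ∀ n, 1 + ε n ≤ C := by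
    obtain ⟨C, hC⟩ := hε.bddAbove_range
    exact ⟨1 + C, fun n => by linarith [hC ⟨n, rfl⟩]⟩
  refine ⟨hJ, V, ⟨?_, ?_⟩, ?_⟩
  · rw [Submodule.disjoint_def]
    intro f hf hfV
    ext a
    have h1 : Tendsto (fun n => f (Φ n a)) U (𝓝 0) := by
      simp [fun n => hf _ (hmem n a)]
    exact tendsto_nhds_unique (hfV a) h1
  · rw [codisjoint_iff, Submodule.eq_top_iff']
    intro f
    obtain ⟨C, hC⟩ := hεbdd
    have hmemball : ∀ n, StrongDual.toWeakDual (f.comp (Φ n)) ∈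
        (WeakDual.toStrongDual ⁻¹' Metric.closedBall (0 : StrongDual 𝕜 E) (‖f‖ * C)) := by
      intro n
      have hC0 : 0 ≤ C := by linarith [hC 0, hε0 0]
      have hΦ : ‖Φ n‖ ≤ C := (Φ n).opNorm_le_bound hC0 fun a => by
        have h1 := hbound n a 0
        rw [map_zero, sub_zero, add_zero, norm_zero, max_eq_left (norm_nonneg a)] at h1
        exact h1.trans (mul_le_mul_of_nonneg_right (hC n) (norm_nonneg a))
      rw [Set.mem_preimage, mem_closedBall_zero_iff]
      exact (f.opNorm_comp_le (Φ n)).trans (mul_le_mul_of_nonneg_left hΦ (norm_nonneg f))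
    obtain ⟨g, -, hg⟩ := (WeakDual.isCompact_closedBall (𝕜 := 𝕜) (0 : StrongDual 𝕜 E)
      (‖f‖ * C)).ultrafilter_le_nhds (U.map fun n => StrongDual.toWeakDual (f.comp (Φ n)))
      (by
        rw [Ultrafilter.coe_map, le_principal_iff]
        exact mem_map.2 (Eventually.of_forall hmemball))
    have hgt : ∀ a, Tendsto (fun n => f (Φ n a)) U (𝓝 (g a)) := fun a =>
      ((WeakDual.eval_continuous a).tendsto g).comp
        (show Tendsto (fun n => StrongDual.toWeakDual (f.comp (Φ n))) U (𝓝 g) from hg)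
    have hgJ : ∀ a ∈ J, f a = g a := fun a ha =>
      tendsto_nhds_unique (((f.continuous.tendsto a).comp (hlim a ha)).mono_left hU) (hgt a)
    have hgV : WeakDual.toStrongDual g ∈ V := by
      intro a
      refine (hgt a).congr fun n => ?_
      exact hgJ _ (hmem n a)
    rw [← sub_add_cancel f (WeakDual.toStrongDual g)]
    refine Submodule.add_mem_sup (fun a ha => ?_) hgV
    exact sub_eq_zero.2 (hgJ a ha)
  · intro f hf g hg
    refine le_antisymm (norm_add_le f g) (norm_add_norm_le_of_joint_bound
      (norm_nonneg _) fun S T => ?_)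
    have h1 : Tendsto (fun n => (f + g) (Φ n T + (S - Φ n S))) U (𝓝 (g T + (f S + g S - g S))) := by
      have h2 : ∀ n, (f + g) (Φ n T + (S - Φ n S)) = g (Φ n T) + (f S + g S - g (Φ n S)) := by
        intro n
        simp only [add_apply, map_add, map_sub, hf _ (hmem n T),
          hf _ (hmem n S)]
        ring
      simp only [h2]
      exact (hg T).add (tendsto_const_nhds.sub (hg S))
    have h3 : Tendsto (fun n => ‖f + g‖ * ((1 + ε n) * max ‖S‖ ‖T‖)) U
        (𝓝 (‖f + g‖ * ((1 + 0) * max ‖S‖ ‖T‖))) :=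
      (((hε.mono_left hU).const_add 1).mul_const _).const_mul _
    have h4 := le_of_tendsto_of_tendsto' h1.norm h3 fun n =>
      ((f + g).le_opNorm _).trans (mul_le_mul_of_nonneg_left
        ((hbound n T S).trans_eq (by rw [max_comm])) (norm_nonneg _))
    rwa [add_zero, one_mul, add_sub_cancel_right, add_comm] at h4

end Criterion

/-! ### Operators into a space with an approximating sequence of compact operators -/

section Operators

variable {𝕜 X Y Z : Type*} [RCLike 𝕜] [NormedAddCommGroup X] [NormedSpace 𝕜 X]
  [NormedAddCommGroup Y] [NormedSpace 𝕜 Y] [NormedAddCommGroup Z] [NormedSpace 𝕜 Z]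

lemma totallyBounded_image_ball {S : X →L[𝕜] Y} (hS : IsCompactOperator S) :
    TotallyBounded (S '' Metric.ball 0 1) :=
  (hS.isCompact_closure_image_ball (f := (S : X →ₗ[𝕜] Y)) 1).totallyBounded.subset subset_closure

/-- A bounded sequence of operators that converges strongly to the identity converges in norm
after composition with a compact operator. -/
lemma tendsto_comp_compact {L : ℕ → Y →L[𝕜] Y} {C : ℝ} (hC : ∀ n, ‖L n‖ ≤ C)
    (hL : ∀ y, Tendsto (fun n => L n y) atTop (𝓝 y)) {S : X →L[𝕜] Y} (hS : IsCompactOperator S) :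
    Tendsto (fun n => (L n).comp S) atTop (𝓝 S) := by
  have hC0 : 0 ≤ C := (norm_nonneg _).trans (hC 0)
  rw [Metric.tendsto_atTop]
  intro ε hε
  set δ := ε / (2 * (C + 2)) with hδ
  have hδ0 : 0 < δ := by positivity
  obtain ⟨t, -, ht, hcov⟩ := Metric.finite_approx_of_totallyBounded (totallyBounded_image_ball hS)
    δ hδ0
  have hev : ∀ᶠ n in atTop, ∀ y ∈ t, ‖L n y - y‖ < δ := by
    rw [Filter.eventually_all_finite ht]
    intro y _
    simpa [dist_eq_norm] using (Metric.tendsto_nhds.1 (hL y)) δ hδ0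
  obtain ⟨N, hN⟩ := eventually_atTop.1 hev
  refine ⟨N, fun n hn => ?_⟩
  rw [dist_eq_norm]
  refine lt_of_le_of_lt (b := (C + 2) * δ) ?_ (by rw [hδ]; field_simp; linarith)
  refine le_of_not_gt fun hlt => ?_
  obtain ⟨x, hx, hlt⟩ := ((L n).comp S - S).exists_lt_apply_of_lt_opNorm hlt
  refine absurd hlt (not_lt.2 ?_)
  have hSx : S x ∈ S '' Metric.ball 0 1 := ⟨x, mem_ball_zero_iff.2 hx, rfl⟩
  obtain ⟨y, hyt, hy⟩ := Set.mem_iUnion₂.1 (hcov hSx)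
  rw [mem_ball_iff_norm] at hy
  have h1 : ((L n).comp S - S) x = L n (S x - y) + (L n y - y) - (S x - y) := by
    simp only [sub_apply, ContinuousLinearMap.comp_apply, map_sub]
    abel
  have h2 : ‖L n (S x - y)‖ ≤ C * δ :=
    ((L n).le_opNorm _).trans (mul_le_mul (hC n) hy.le (norm_nonneg _) hC0)
  rw [h1]
  linarith [norm_sub_le (L n (S x - y) + (L n y - y)) (S x - y),
    norm_add_le (L n (S x - y)) (L n y - y), hN n hn y hyt]

/-- An operator whose norm is controlled, up to arbitrarily small multiples of `‖x‖`, by operators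
into finite-dimensional spaces is compact. -/
lemma isCompactOperator_of_finiteDimensional_control [CompleteSpace Y] (T : X →L[𝕜] Y)
    (h : ∀ ε > 0, ∃ (ι : Type) (_ : Fintype ι) (R : X →L[𝕜] (ι → 𝕜)),
      ∀ x, ‖T x‖ ≤ ‖R x‖ + ε * ‖x‖) : IsCompactOperator T := by
  refine (isCompactOperator_iff_isCompact_closure_image_ball (T : X →ₗ[𝕜] Y) one_pos).2 ?_
  refine TotallyBounded.isCompact_of_isClosed (TotallyBounded.closure ?_) isClosed_closure
  rw [Metric.totallyBounded_iff]
  intro ε hε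
  obtain ⟨ι, _, R, hR⟩ := h (ε / 4) (by positivity)
  have hRc : IsCompactOperator R := isCompactOperator_of_locallyCompactSpace_dom R
  obtain ⟨t, hts, ht, hcov⟩ := Metric.finite_approx_of_totallyBounded
    (totallyBounded_image_ball hRc) (ε / 4) (by positivity)
  obtain ⟨s, hs1, hs, rfl⟩ := Set.exists_subset_image_finite_and.1 ⟨t, hts, ht, rfl⟩
  refine ⟨T '' s, hs.image T, ?_⟩
  rintro _ ⟨x, hx, rfl⟩
  obtain ⟨_, ⟨y, hy, rfl⟩, hxy⟩ := Set.mem_iUnion₂.1 (hcov ⟨x, hx, rfl⟩)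
  refine Set.mem_iUnion₂.2 ⟨T y, ⟨y, hy, rfl⟩, ?_⟩
  rw [mem_ball_iff_norm, ← map_sub] at hxy
  have h1 := hR (x - y)
  have h2 : ‖x - y‖ ≤ 2 := by
    have hx1 := mem_ball_zero_iff.1 hx
    have hy1 := mem_ball_zero_iff.1 (hs1 hy)
    linarith [norm_sub_le x y]
  have h3 : ε / 4 * ‖x - y‖ ≤ ε / 4 * 2 := by gcongr
  rw [ContinuousLinearMap.coe_coe, mem_ball_iff_norm, ← map_sub]
  linarith

/-- Let `ι : Z → Y` be an isometric embedding and `K n : Y → Z` compact operators that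
converge strongly to the identity on `Z` and satisfy
`‖K n a + (b - K n b)‖ ≤ (1 + o(1)) max ‖a‖ ‖b‖` on `Y`. Then `K(X, Z)` is an M-ideal in `L(X, Y)`,
since the maps `T ↦ K n ∘ T` satisfy the hypotheses of `IsMIdeal.of_approximate_projections`. -/
theorem isMIdeal_compactOperator_map [CompleteSpace Z] (ι : Z →ₗᵢ[𝕜] Y) (K : ℕ → Y →L[𝕜] Z)
    (ε : ℕ → ℝ) (hε0 : ∀ n, 0 ≤ ε n) (hε : Tendsto ε atTop (𝓝 0))
    (hK : ∀ n, IsCompactOperator (K n))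
    (hlim : ∀ z : Z, Tendsto (fun n => K n (ι z)) atTop (𝓝 z))
    (hbound : ∀ n a b, ‖ι (K n a) + (b - ι (K n b))‖ ≤ (1 + ε n) * max ‖a‖ ‖b‖) :
    IsMIdeal (𝕜 := 𝕜) ((compactOperator (RingHom.id 𝕜) X Z).map
      (ContinuousLinearMap.compL 𝕜 X Z Y ι.toContinuousLinearMap).toLinearMap) := by
  obtain ⟨C, hC⟩ := hε.bddAbove_range
  have hKn : ∀ n, ‖(K n).comp ι.toContinuousLinearMap‖ ≤ 1 + C := fun n =>
    ContinuousLinearMap.opNorm_le_bound _ (by linarith [hε0 0, hC ⟨0, rfl⟩]) fun z => by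
      have h1 := hbound n (ι z) 0
      rw [map_zero, map_zero, sub_zero, add_zero, norm_zero, max_eq_left (norm_nonneg _),
        ι.norm_map, ι.norm_map] at h1
      exact h1.trans (mul_le_mul_of_nonneg_right (by linarith [hC ⟨n, rfl⟩]) (norm_nonneg z))
  have hclosed : IsClosed (((compactOperator (RingHom.id 𝕜) X Z).map
      (ContinuousLinearMap.compL 𝕜 X Z Y ι.toContinuousLinearMap).toLinearMap :
        Submodule 𝕜 (X →L[𝕜] Y)) : Set (X →L[𝕜] Y)) := by
    have hiso : Isometry (ContinuousLinearMap.compL 𝕜 X Z Y ι.toContinuousLinearMap) :=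
      AddMonoidHomClass.isometry_of_norm _ fun S => ι.norm_toContinuousLinearMap_comp
    exact hiso.isClosedEmbedding.isClosedMap _ isClosed_setOfPred_isCompactOperator
  refine IsMIdeal.of_approximate_projections hclosed
    (fun n => ContinuousLinearMap.compL 𝕜 X Y Y (ι.toContinuousLinearMap.comp (K n))) ε hε0 hε
    ?_ ?_ ?_
  · exact fun n T => ⟨(K n).comp T, (hK n).comp_clm T, rfl⟩
  · rintro _ ⟨S, hS, rfl⟩
    have h1 := tendsto_comp_compact hKn (fun z => hlim z) hS
    exact ((ContinuousLinearMap.compL 𝕜 X Z Y ι.toContinuousLinearMap).continuous.tendsto S).comp h1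
  · intro n A B
    have h0 : 0 ≤ 1 + ε n := by linarith [hε0 n]
    refine ContinuousLinearMap.opNorm_le_bound _ (by positivity) fun x => ?_
    refine (hbound n (A x) (B x)).trans ?_
    rw [mul_assoc, max_mul_of_nonneg _ _ (norm_nonneg x)]
    exact mul_le_mul_of_nonneg_left (max_le_max (A.le_opNorm x) (B.le_opNorm x)) h0

end Operators

/-! ### Pointwise estimates in the Bloch space -/

namespace BlochSpace

lemma weighted_le_norm (f : BlochSpace) (z : 𝔻) : (1 - ‖(z : ℂ)‖ ^ 2) * ‖f z‖ ≤ ‖f‖ :=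
  f.le_iSup_weighted z

lemma norm_le_of_weighted_le {f : BlochSpace} {C : ℝ}
    (h : ∀ z : 𝔻, (1 - ‖(z : ℂ)‖ ^ 2) * ‖f z‖ ≤ C) : ‖f‖ ≤ C :=
  ciSup_le h

lemma coe_sub (f g : BlochSpace) : ⇑(f - g) = ⇑f - ⇑g := rfl

lemma coe_sum {ι : Type*} (s : Finset ι) (f : ι → BlochSpace) (z : 𝔻) :
    (∑ i ∈ s, f i) z = ∑ i ∈ s, f i z := by
  classical
  induction s using Finset.induction_on with
  | empty => rfl
  | insert i s hi ih => rw [Finset.sum_insert hi, Finset.sum_insert hi, coe_add, Pi.add_apply, ih]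

lemma one_sub_mul_norm_le (f : BlochSpace) (z : 𝔻) : (1 - ‖(z : ℂ)‖) * ‖f z‖ ≤ ‖f‖ := by
  refine le_trans (mul_le_mul_of_nonneg_right ?_ (norm_nonneg _)) (f.weighted_le_norm z)
  nlinarith [norm_nonneg (z : ℂ), z.norm_lt_one]

/-- On `|z| ≤ ρ < 1` the functions of the unit ball of `β` are uniformly Lipschitz, by the Cauchy
estimate on discs of radius `(1 - ρ) / 2`. -/
lemma norm_sub_le_of_norm_le (f : BlochSpace) {ρ : ℝ} (hρ : ρ < 1) {z w : 𝔻}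
    (hz : ‖(z : ℂ)‖ ≤ ρ) (hw : ‖(w : ℂ)‖ ≤ ρ) :
    ‖f z - f w‖ ≤ 4 * ‖f‖ / (1 - ρ) ^ 2 * ‖(z : ℂ) - w‖ := by
  obtain ⟨F, hF, hfF⟩ := f.2.1
  have h1ρ : 0 < 1 - ρ := sub_pos.2 hρ
  have hFd : DifferentiableOn ℂ F (Metric.ball 0 1) := hF.differentiableOn
  have hbound : ∀ x ∈ Metric.closedBall (0 : ℂ) ((1 + ρ) / 2), ‖F x‖ ≤ 2 * ‖f‖ / (1 - ρ) := by
    intro x hx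
    rw [mem_closedBall_zero_iff] at hx
    have hx1 : ‖x‖ < 1 := by linarith
    have h1 := f.one_sub_mul_norm_le (Complex.UnitDisc.mk x hx1)
    rw [hfF, Complex.UnitDisc.coe_mk] at h1
    rw [le_div_iff₀ h1ρ]
    nlinarith [norm_nonneg (F x)]
  rw [hfF, hfF]
  refine Convex.norm_image_sub_le_of_norm_deriv_le (s := Metric.closedBall (0 : ℂ) ρ) ?_ ?_
    (convex_closedBall 0 ρ) (mem_closedBall_zero_iff.2 hw) (mem_closedBall_zero_iff.2 hz)
  · intro x hx
    rw [mem_closedBall_zero_iff] at hx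
    exact (hF x (mem_ball_zero_iff.2 (hx.trans_lt hρ))).differentiableAt
  · intro x hx
    rw [mem_closedBall_zero_iff] at hx
    have hsub : Metric.closedBall x ((1 - ρ) / 2) ⊆ Metric.closedBall (0 : ℂ) ((1 + ρ) / 2) :=
      Metric.closedBall_subset_closedBall' (by rw [dist_zero_right]; linarith)
    have h1 : ‖deriv F x‖ ≤ 2 * ‖f‖ / (1 - ρ) / ((1 - ρ) / 2) := by
      refine Complex.norm_deriv_le_of_forall_mem_sphere_norm_le (by linarith) ?_ fun y hy =>
        hbound y (hsub (Metric.sphere_subset_closedBall hy))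
      refine (hFd.mono ?_).diffContOnCl_ball (U := Metric.closedBall 0 ((1 + ρ) / 2)) hsub
      exact Metric.closedBall_subset_ball (by linarith)
    refine h1.trans_eq ?_
    field_simp
    ring

/-- `β` is complete: a Cauchy sequence converges pointwise, uniformly on compact sets, and the limit
is analytic by Weierstrass' theorem. -/
instance : CompleteSpace BlochSpace := by
  refine Metric.complete_of_cauchySeq_tendsto fun u hu => ?_
  have hpt : ∀ n m (z : 𝔻), (1 - ‖(z : ℂ)‖ ^ 2) * ‖u n z - u m z‖ ≤ dist (u n) (u m) :=
    fun n m z => by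
      rw [dist_eq_norm]
      exact (u n - u m).weighted_le_norm z
  have hcauchy : ∀ z : 𝔻, CauchySeq fun n => u n z := by
    intro z
    have hz : 0 < 1 - ‖(z : ℂ)‖ ^ 2 := sub_pos.2 z.sq_norm_lt_one
    rw [Metric.cauchySeq_iff'] at hu ⊢
    intro ε hε
    obtain ⟨N, hN⟩ := hu ((1 - ‖(z : ℂ)‖ ^ 2) * ε) (by positivity)
    refine ⟨N, fun n hn => ?_⟩
    rw [dist_eq_norm]
    exact lt_of_mul_lt_mul_left ((hpt n N z).trans_lt (hN n hn)) hz.le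
  choose f hf using fun z => cauchySeq_tendsto_of_complete (hcauchy z)
  have hlim : ∀ ε > 0, ∃ N, ∀ n ≥ N, ∀ z : 𝔻, (1 - ‖(z : ℂ)‖ ^ 2) * ‖u n z - f z‖ ≤ ε := by
    intro ε hε
    obtain ⟨N, hN⟩ := Metric.cauchySeq_iff.1 hu ε hε
    refine ⟨N, fun n hn z => ?_⟩
    refine le_of_tendsto ((tendsto_const_nhds.sub (hf z)).norm.const_mul _) ?_
    filter_upwards [eventually_ge_atTop N] with m hm
    exact (hpt n m z).trans (hN n hn m hm).le
  have hana : AnalyticOnDisc f := by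
    choose F hF huF using fun n => (u n).2.1
    let G : ℂ → ℂ := fun z => if hz : ‖z‖ < 1 then f (Complex.UnitDisc.mk z hz) else 0
    have hG : TendstoLocallyUniformlyOn F G atTop (Metric.ball 0 1) := by
      rw [tendstoLocallyUniformlyOn_iff_forall_isCompact Metric.isOpen_ball]
      intro K hK hKc
      obtain ⟨ρ, hρ0, hρ, hKρ⟩ : ∃ ρ, 0 ≤ ρ ∧ ρ < 1 ∧ ∀ z ∈ K, ‖z‖ ≤ ρ := by
        rcases K.eq_empty_or_nonempty with rfl | hne
        · exact ⟨0, le_rfl, one_pos, by simp⟩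
        · obtain ⟨x, hx, hmax⟩ := hKc.exists_isMaxOn hne continuous_norm.continuousOn
          exact ⟨‖x‖, norm_nonneg x, mem_ball_zero_iff.1 (hK hx), fun z hz => hmax hz⟩
      have hρ2 : 0 < 1 - ρ ^ 2 := by nlinarith
      rw [Metric.tendstoUniformlyOn_iff]
      intro ε hε
      obtain ⟨N, hN⟩ := hlim ((1 - ρ ^ 2) * (ε / 2)) (by positivity)
      filter_upwards [eventually_ge_atTop N] with n hn z hz
      have hz1 : ‖z‖ < 1 := (hKρ z hz).trans_lt hρ
      have h1 := hN n hn (Complex.UnitDisc.mk z hz1)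
      rw [Complex.UnitDisc.coe_mk, huF, Complex.UnitDisc.coe_mk] at h1
      have h2 : (1 - ρ ^ 2) * ‖F n z - f (Complex.UnitDisc.mk z hz1)‖ ≤ (1 - ρ ^ 2) * (ε / 2) := by
        refine le_trans (mul_le_mul_of_nonneg_right ?_ (norm_nonneg _)) h1
        have := pow_le_pow_left₀ (norm_nonneg z) (hKρ z hz) 2
        linarith
      rw [dist_comm, dist_eq_norm]
      simp only [G, hz1, dif_pos]
      linarith [le_of_mul_le_mul_left h2 hρ2]
    refine ⟨G, (hG.differentiableOn (Eventually.of_forall fun n => (hF n).differentiableOn)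
      Metric.isOpen_ball).analyticOnNhd Metric.isOpen_ball, fun z => ?_⟩
    simp [G, z.norm_lt_one]
  have hbdd : BddAbove (Set.range (blochWeighted f)) := by
    obtain ⟨N, hN⟩ := hlim 1 one_pos
    refine ⟨‖u N‖ + 1, ?_⟩
    rintro _ ⟨z, rfl⟩
    have h1 := (u N).weighted_le_norm z
    have h2 := hN N le_rfl z
    have h3 := mul_le_mul_of_nonneg_left (norm_sub_le (u N z) (u N z - f z)) (one_sub_sq_nonneg z)
    rw [sub_sub_cancel] at h3
    rw [blochWeighted]
    linarith
  obtain ⟨g, rfl⟩ : ∃ g : BlochSpace, ⇑g = f := ⟨⟨f, hana, hbdd⟩, rfl⟩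
  refine ⟨g, Metric.tendsto_atTop.2 fun ε hε => ?_⟩
  obtain ⟨N, hN⟩ := hlim (ε / 2) (by positivity)
  refine ⟨N, fun n hn => ?_⟩
  rw [dist_eq_norm]
  exact (norm_le_of_weighted_le (f := u n - g) (hN n hn)).trans_lt (by linarith)

end BlochSpace

lemma mem_littleBloch_iff {f : BlochSpace} :
    f ∈ littleBloch ↔ ∀ ε > 0, ∃ s > 0, ∀ z : 𝔻, 1 - ‖(z : ℂ)‖ < s →
      (1 - ‖(z : ℂ)‖ ^ 2) * ‖f z‖ ≤ ε := by
  have hnorm : ∀ z : 𝔻, ‖((1 - ‖(z : ℂ)‖ ^ 2 : ℝ) : ℂ) * f z‖ = (1 - ‖(z : ℂ)‖ ^ 2) * ‖f z‖ :=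
    fun z => by rw [norm_mul, Complex.norm_real, Real.norm_of_nonneg (one_sub_sq_nonneg z)]
  have hmem : f ∈ littleBloch ↔ Tendsto (fun z : 𝔻 => ((1 - ‖(z : ℂ)‖ ^ 2 : ℝ) : ℂ) * f z)
    (comap (fun z : 𝔻 => ‖(z : ℂ)‖) (𝓝 1)) (𝓝 0) := Iff.rfl
  rw [hmem, Metric.nhds_basis_ball.comap _ |>.tendsto_iff Metric.nhds_basis_closedBall]
  simp only [Set.mem_preimage, Metric.mem_ball, mem_closedBall_zero_iff, hnorm, Real.dist_eq]
  have habs : ∀ z : 𝔻, |‖(z : ℂ)‖ - 1| = 1 - ‖(z : ℂ)‖ := fun z => by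
    rw [abs_sub_comm, abs_of_pos (sub_pos.2 z.norm_lt_one)]
  simp only [habs]

lemma isClosed_littleBloch : IsClosed (littleBloch : Set BlochSpace) := by
  refine isClosed_of_closure_subset fun f hf => ?_
  rw [SetLike.mem_coe, mem_littleBloch_iff]
  intro ε hε
  obtain ⟨g, hg, hfg⟩ := Metric.mem_closure_iff.1 hf (ε / 2) (by positivity)
  obtain ⟨s, hs, hgs⟩ := mem_littleBloch_iff.1 hg (ε / 2) (by positivity)
  refine ⟨s, hs, fun z hz => ?_⟩
  rw [dist_eq_norm] at hfg
  have h1 := (f - g).weighted_le_norm z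
  have h2 := mul_le_mul_of_nonneg_left (norm_add_le (f z - g z) (g z)) (one_sub_sq_nonneg z)
  rw [sub_add_cancel] at h2
  rw [BlochSpace.coe_sub, Pi.sub_apply] at h1
  linarith [hgs z hz]

instance : CompleteSpace littleBloch := isClosed_littleBloch.completeSpace_coe

/-! ### Dilations -/

namespace BlochSpace

lemma norm_mul_le_right (a z : 𝔻) : ‖((a * z : 𝔻) : ℂ)‖ ≤ ‖(z : ℂ)‖ := by
  rw [Complex.UnitDisc.coe_mul, norm_mul]
  exact mul_le_of_le_one_left (norm_nonneg _) a.norm_lt_one.le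

lemma norm_mul_le_left (a z : 𝔻) : ‖((a * z : 𝔻) : ℂ)‖ ≤ ‖(a : ℂ)‖ := by
  rw [mul_comm]
  exact norm_mul_le_right z a

lemma weighted_dilate_le (f : BlochSpace) (a z : 𝔻) :
    (1 - ‖(z : ℂ)‖ ^ 2) * ‖f (a * z)‖ ≤ (1 - ‖((a * z : 𝔻) : ℂ)‖ ^ 2) * ‖f (a * z)‖ := by
  have := pow_le_pow_left₀ (norm_nonneg _) (norm_mul_le_right a z) 2
  exact mul_le_mul_of_nonneg_right (by linarith) (norm_nonneg _)

lemma one_sub_sq_le (z : 𝔻) : 1 - ‖(z : ℂ)‖ ^ 2 ≤ 2 * (1 - ‖(z : ℂ)‖) := by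
  nlinarith [sq_nonneg (1 - ‖(z : ℂ)‖)]

lemma weighted_dilate_le_div (f : BlochSpace) (a z : 𝔻) :
    (1 - ‖(z : ℂ)‖ ^ 2) * ‖f (a * z)‖ ≤ 2 * (1 - ‖(z : ℂ)‖) / (1 - ‖(a : ℂ)‖) * ‖f‖ := by
  have ha : 0 < 1 - ‖(a : ℂ)‖ := sub_pos.2 a.norm_lt_one
  have hz : 0 < 1 - ‖(z : ℂ)‖ := sub_pos.2 z.norm_lt_one
  have h1 : (1 - ‖(a : ℂ)‖) * ‖f (a * z)‖ ≤ ‖f‖ :=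
    (mul_le_mul_of_nonneg_right (by linarith [norm_mul_le_left a z]) (norm_nonneg _)).trans
      (f.one_sub_mul_norm_le (a * z))
  have h2 : ‖f (a * z)‖ ≤ ‖f‖ / (1 - ‖(a : ℂ)‖) := by
    rw [le_div_iff₀ ha, mul_comm]
    exact h1
  calc (1 - ‖(z : ℂ)‖ ^ 2) * ‖f (a * z)‖
      ≤ 2 * (1 - ‖(z : ℂ)‖) * (‖f‖ / (1 - ‖(a : ℂ)‖)) :=
        mul_le_mul (one_sub_sq_le z) h2 (norm_nonneg _) (by positivity)
    _ = 2 * (1 - ‖(z : ℂ)‖) / (1 - ‖(a : ℂ)‖) * ‖f‖ := by ring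

lemma weighted_sub_dilate_le_div (f : BlochSpace) (a z : 𝔻) :
    (1 - ‖(z : ℂ)‖ ^ 2) * ‖f z - f (a * z)‖ ≤ 8 * ‖1 - (a : ℂ)‖ / (1 - ‖(z : ℂ)‖) * ‖f‖ := by
  have hz : 0 < 1 - ‖(z : ℂ)‖ := sub_pos.2 z.norm_lt_one
  have h1 := f.norm_sub_le_of_norm_le z.norm_lt_one le_rfl (norm_mul_le_right a z)
  have h2 : ‖(z : ℂ) - (a * z : 𝔻)‖ ≤ ‖1 - (a : ℂ)‖ := by
    rw [Complex.UnitDisc.coe_mul, show (z : ℂ) - a * z = (1 - a) * z by ring, norm_mul]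
    exact mul_le_of_le_one_right (norm_nonneg _) z.norm_lt_one.le
  calc (1 - ‖(z : ℂ)‖ ^ 2) * ‖f z - f (a * z)‖
      ≤ 2 * (1 - ‖(z : ℂ)‖) * (4 * ‖f‖ / (1 - ‖(z : ℂ)‖) ^ 2 * ‖1 - (a : ℂ)‖) :=
        mul_le_mul (one_sub_sq_le z)
          (h1.trans (mul_le_mul_of_nonneg_left h2 (by positivity))) (norm_nonneg _)
          (by positivity)
    _ = 8 * ‖1 - (a : ℂ)‖ / (1 - ‖(z : ℂ)‖) * ‖f‖ := by
        field_simp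
        ring

/-- The function `z ↦ f (a z)` as an element of `β`. -/
def dilate (a : 𝔻) (f : BlochSpace) : BlochSpace :=
  ⟨fun z => f (a * z), by
    obtain ⟨F, hF, hfF⟩ := f.2.1
    refine ⟨fun z => F (a * z), fun z hz => ?_, fun z => ?_⟩
    · have haz : (a : ℂ) * z ∈ Metric.ball (0 : ℂ) 1 := by
        rw [mem_ball_zero_iff] at hz ⊢
        rw [norm_mul]
        exact mul_lt_one_of_nonneg_of_lt_one_left (norm_nonneg _) a.norm_lt_one hz.le
      exact (hF _ haz).comp (analyticAt_const.mul analyticAt_id)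
    · exact (hfF (a * z)).trans (congrArg F (Complex.UnitDisc.coe_mul a z)), by
    refine ⟨‖f‖, ?_⟩
    rintro _ ⟨z, rfl⟩
    exact (f.weighted_dilate_le a z).trans (f.weighted_le_norm _)⟩

lemma dilate_apply (a : 𝔻) (f : BlochSpace) (z : 𝔻) : dilate a f z = f (a * z) := rfl

lemma dilate_mem_littleBloch (a : 𝔻) (f : BlochSpace) : dilate a f ∈ littleBloch := by
  rw [mem_littleBloch_iff]
  intro ε hε
  have ha : 0 < 1 - ‖(a : ℂ)‖ := sub_pos.2 a.norm_lt_one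
  refine ⟨ε * (1 - ‖(a : ℂ)‖) / (2 * (‖f‖ + 1)), by positivity, fun z hz => ?_⟩
  rw [dilate_apply]
  refine (f.weighted_dilate_le_div a z).trans ?_
  rw [lt_div_iff₀ (by positivity)] at hz
  rw [div_mul_eq_mul_div, div_le_iff₀ ha]
  nlinarith [norm_nonneg f, z.norm_lt_one]

/-- The dilation operator `f ↦ f (a ·)` from `β` into `β₀`. -/
def dilation (a : 𝔻) : BlochSpace →L[ℂ] littleBloch :=
  LinearMap.mkContinuous
    { toFun := fun f => ⟨dilate a f, dilate_mem_littleBloch a f⟩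
      map_add' := fun _ _ => rfl
      map_smul' := fun _ _ => rfl } 1 fun f => by
    rw [one_mul]
    exact norm_le_of_weighted_le (f := dilate a f) fun z =>
      (f.weighted_dilate_le a z).trans (f.weighted_le_norm _)

lemma dilation_apply (a : 𝔻) (f : BlochSpace) (z : 𝔻) :
    (dilation a f : BlochSpace) z = f (a * z) := rfl

/-- Evaluation at a point of the disc. -/
def evalCLM (z : 𝔻) : BlochSpace →L[ℂ] ℂ :=
  LinearMap.mkContinuous
    { toFun := fun f => f z
      map_add' := fun _ _ => rfl
      map_smul' := fun _ _ => rfl } (1 - ‖(z : ℂ)‖)⁻¹ fun f => by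
    have hz : 0 < 1 - ‖(z : ℂ)‖ := sub_pos.2 z.norm_lt_one
    rw [inv_mul_eq_div, le_div_iff₀ hz, mul_comm]
    exact f.one_sub_mul_norm_le z

/-- `f (a ·)` only depends on the values of `f` on `|w| ≤ |a|`, which are determined up to
`ε ‖f‖` by those on a finite net. -/
lemma isCompactOperator_dilation (a : 𝔻) : IsCompactOperator (dilation a) := by
  refine isCompactOperator_of_finiteDimensional_control _ fun ε hε => ?_
  have ha : 0 < 1 - ‖(a : ℂ)‖ := sub_pos.2 a.norm_lt_one
  set δ := ε * (1 - ‖(a : ℂ)‖) ^ 2 / 4 with hδ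
  obtain ⟨t, hta, ht, hcov⟩ := Metric.finite_approx_of_totallyBounded
    (isCompact_closedBall (0 : ℂ) ‖(a : ℂ)‖).totallyBounded δ (by positivity)
  have hta' : ∀ p ∈ t, ‖p‖ ≤ ‖(a : ℂ)‖ := fun p hp => mem_closedBall_zero_iff.1 (hta hp)
  have := ht.fintype
  let R : BlochSpace →L[ℂ] (t → ℂ) := ContinuousLinearMap.pi fun p =>
    evalCLM (Complex.UnitDisc.mk p ((hta' p p.2).trans_lt a.norm_lt_one))
  refine ⟨t, inferInstance, R, fun f => ?_⟩
  refine norm_le_of_weighted_le (f := (dilation a f : BlochSpace)) fun z => ?_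
  rw [dilation_apply]
  obtain ⟨p, hp, hzp⟩ := Set.mem_iUnion₂.1
    (hcov (mem_closedBall_zero_iff.2 (norm_mul_le_left a z)))
  rw [mem_ball_iff_norm] at hzp
  have hp1 : ‖p‖ < 1 := (hta' p hp).trans_lt a.norm_lt_one
  have h1 := f.norm_sub_le_of_norm_le (w := Complex.UnitDisc.mk p hp1) a.norm_lt_one
    (norm_mul_le_left a z) (hta' p hp)
  rw [Complex.UnitDisc.coe_mk] at h1
  have h2 : 4 * ‖f‖ / (1 - ‖(a : ℂ)‖) ^ 2 * ‖((a * z : 𝔻) : ℂ) - p‖ ≤ ε * ‖f‖ := by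
    refine (mul_le_mul_of_nonneg_left hzp.le (by positivity)).trans_eq ?_
    rw [hδ]
    field_simp
  have h3 : ‖f (Complex.UnitDisc.mk p hp1)‖ ≤ ‖R f‖ := norm_le_pi_norm (R f) ⟨p, hp⟩
  have h4 : (1 - ‖(z : ℂ)‖ ^ 2) * ‖f (a * z)‖ ≤ ‖f (a * z)‖ :=
    mul_le_of_le_one_left (norm_nonneg _) (by linarith [sq_nonneg ‖(z : ℂ)‖])
  linarith [norm_sub_norm_le (f (a * z)) (f (Complex.UnitDisc.mk p hp1))]

lemma norm_dilation_sub_le {f : BlochSpace} (hf : f ∈ littleBloch) {ε : ℝ} (hε : 0 < ε) :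
    ∃ η > 0, ∀ a : 𝔻, ‖1 - (a : ℂ)‖ < η → ‖(dilation a f : BlochSpace) - f‖ ≤ ε := by
  obtain ⟨s, hs, hfs⟩ := mem_littleBloch_iff.1 hf (ε / 2) (by positivity)
  refine ⟨min (s / 2) (ε * s / (16 * (‖f‖ + 1))), by positivity, fun a ha => ?_⟩
  obtain ⟨ha1, ha2⟩ := lt_min_iff.1 ha
  refine norm_le_of_weighted_le fun z => ?_
  rw [coe_sub, Pi.sub_apply, dilation_apply, norm_sub_rev]
  have hz : 0 < 1 - ‖(z : ℂ)‖ := sub_pos.2 z.norm_lt_one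
  rcases lt_or_ge (1 - ‖(z : ℂ)‖) (s / 2) with hzs | hzs
  · have h1 : 1 - ‖((a * z : 𝔻) : ℂ)‖ < s := by
      have h2 : ‖(z : ℂ) - (a * z : 𝔻)‖ ≤ ‖1 - (a : ℂ)‖ := by
        rw [Complex.UnitDisc.coe_mul, show (z : ℂ) - a * z = (1 - a) * z by ring, norm_mul]
        exact mul_le_of_le_one_right (norm_nonneg _) z.norm_lt_one.le
      linarith [norm_sub_norm_le (z : ℂ) (a * z : 𝔻)]
    have h3 := mul_le_mul_of_nonneg_left (norm_sub_le (f z) (f (a * z))) (one_sub_sq_nonneg z)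
    linarith [hfs z (by linarith), hfs _ h1, f.weighted_dilate_le a z]
  · refine (f.weighted_sub_dilate_le_div a z).trans ?_
    rw [lt_div_iff₀ (by positivity)] at ha2
    rw [div_mul_eq_mul_div, div_le_iff₀ hz]
    nlinarith [norm_nonneg f, norm_nonneg (1 - (a : ℂ))]

/-! ### Averages of dilations at well separated scales -/

/-- The distance to `1` of the `j`-th dilation factor at stage `n`: the powers of `(n + 2)⁻²`. -/
def dilationGap (n j : ℕ) : ℝ := ((n + 2 : ℝ)⁻¹) ^ (2 * (j + 1))

lemma dilationGap_pos (n j : ℕ) : 0 < dilationGap n j := by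
  unfold dilationGap
  positivity

lemma inv_add_two_le_one (n : ℕ) : (n + 2 : ℝ)⁻¹ ≤ 1 :=
  inv_le_one_of_one_le₀ (by linarith [(Nat.cast_nonneg n : (0 : ℝ) ≤ n)])

lemma dilationGap_le (n j : ℕ) : dilationGap n j ≤ (n + 2 : ℝ)⁻¹ :=
  pow_le_of_le_one (by positivity) (inv_add_two_le_one n) (by omega)

lemma dilationGap_lt_one (n j : ℕ) : dilationGap n j < 1 :=
  (dilationGap_le n j).trans_lt
    (inv_lt_one_of_one_lt₀ (by linarith [(Nat.cast_nonneg n : (0 : ℝ) ≤ n)]))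

lemma dilationGap_le_sq_mul {n j k : ℕ} (h : j < k) :
    dilationGap n k ≤ (n + 2 : ℝ)⁻¹ ^ 2 * dilationGap n j := by
  unfold dilationGap
  rw [← pow_add]
  exact pow_le_pow_of_le_one (by positivity) (inv_add_two_le_one n) (by omega)

/-- The `j`-th dilation factor at stage `n`. -/
def dilationPoint (n j : ℕ) : 𝔻 :=
  Complex.UnitDisc.mk ((1 - dilationGap n j : ℝ) : ℂ) (by
    rw [Complex.norm_real, Real.norm_of_nonneg] <;>
      linarith [dilationGap_pos n j, dilationGap_lt_one n j])

lemma one_sub_norm_dilationPoint (n j : ℕ) :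
    1 - ‖(dilationPoint n j : ℂ)‖ = dilationGap n j := by
  rw [dilationPoint, Complex.UnitDisc.coe_mk, Complex.norm_real, Real.norm_of_nonneg,
    sub_sub_cancel]
  linarith [dilationGap_lt_one n j]

lemma norm_one_sub_dilationPoint (n j : ℕ) :
    ‖1 - (dilationPoint n j : ℂ)‖ = dilationGap n j := by
  rw [dilationPoint, Complex.UnitDisc.coe_mk, Complex.ofReal_sub, Complex.ofReal_one,
    sub_sub_cancel, Complex.norm_real, Real.norm_of_nonneg (dilationGap_pos n j).le]

/-- The mean of the first `n + 2` dilations at stage `n`. -/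
def meanDilation (n : ℕ) : BlochSpace →L[ℂ] littleBloch :=
  (n + 2 : ℂ)⁻¹ • ∑ j ∈ Finset.range (n + 2), dilation (dilationPoint n j)

lemma isCompactOperator_meanDilation (n : ℕ) : IsCompactOperator (meanDilation n) := by
  have h : meanDilation n ∈ compactOperator (RingHom.id ℂ) BlochSpace littleBloch :=
    Submodule.smul_mem _ _ (Submodule.sum_mem _ fun j _ => isCompactOperator_dilation _)
  exact h

lemma norm_inv_natCast_add_two (n : ℕ) : ‖(n + 2 : ℂ)⁻¹‖ = (n + 2 : ℝ)⁻¹ := by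
  rw [norm_inv]
  congr 1
  exact_mod_cast Complex.norm_natCast (n + 2)

lemma natCast_add_two_ne_zero (n : ℕ) : (n + 2 : ℂ) ≠ 0 := by
  exact_mod_cast Nat.succ_ne_zero (n + 1)

lemma tendsto_meanDilation (f : littleBloch) :
    Tendsto (fun n => meanDilation n f) atTop (𝓝 f) := by
  rw [Metric.tendsto_atTop]
  intro ε hε
  obtain ⟨η, hη, hf⟩ := norm_dilation_sub_le f.2 (half_pos hε)
  obtain ⟨N, hN⟩ := exists_nat_gt η⁻¹
  refine ⟨N, fun n hn => ?_⟩
  have hgap : (n + 2 : ℝ)⁻¹ < η := by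
    rw [inv_lt_comm₀ (by positivity) hη]
    have : (N : ℝ) ≤ n := by exact_mod_cast hn
    linarith
  have h1 : meanDilation n f - f =
      (n + 2 : ℂ)⁻¹ • ∑ j ∈ Finset.range (n + 2), (dilation (dilationPoint n j) f - f) := by
    rw [Finset.sum_sub_distrib, Finset.sum_const, Finset.card_range, smul_sub,
      ← Nat.cast_smul_eq_nsmul ℂ, smul_smul]
    push_cast
    rw [inv_mul_cancel₀ (natCast_add_two_ne_zero n), one_smul, meanDilation]
    simp only [smul_apply, sum_apply]
  rw [dist_eq_norm, h1, norm_smul, norm_inv_natCast_add_two]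
  have h2 : ‖∑ j ∈ Finset.range (n + 2), (dilation (dilationPoint n j) f - f)‖ ≤
      ∑ j ∈ Finset.range (n + 2), ε / 2 :=
    norm_sum_le_of_le _ fun j _ => hf _
      (by rw [norm_one_sub_dilationPoint]; exact (dilationGap_le n j).trans_lt hgap)
  rw [Finset.sum_const, Finset.card_range, nsmul_eq_mul] at h2
  push_cast at h2
  rw [inv_mul_lt_iff₀ (by positivity)]
  have : 0 < (n + 2 : ℝ) * (ε / 2) := by positivity
  linarith

/-- At a fixed point `z`, the scale `j` is critical at stage `n` if `1 - |z|` and the gap of the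
`j`-th dilation are comparable within the factor `n + 2`. -/
def IsCritical (n : ℕ) (z : 𝔻) (j : ℕ) : Prop :=
  (n + 2 : ℝ)⁻¹ * dilationGap n j < 1 - ‖(z : ℂ)‖ ∧
    (n + 2 : ℝ)⁻¹ * (1 - ‖(z : ℂ)‖) < dilationGap n j

lemma IsCritical.le {n : ℕ} {z : 𝔻} {j k : ℕ} (hj : IsCritical n z j) (hk : IsCritical n z k) :
    k ≤ j := by
  by_contra! hlt
  have hη : (0 : ℝ) < (n + 2 : ℝ)⁻¹ := by positivity
  have h1 : (n + 2 : ℝ)⁻¹ * (1 - ‖(z : ℂ)‖) <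
      (n + 2 : ℝ)⁻¹ * ((n + 2 : ℝ)⁻¹ * dilationGap n j) := by
    refine (hk.2.trans_le (dilationGap_le_sq_mul hlt)).trans_eq ?_
    ring
  exact lt_asymm (lt_of_mul_lt_mul_left h1 hη.le) hj.1

open Classical in
/-- One term of the average: for a noncritical scale, either `f (a z)` and `g (a z)` are both
negligible or `g z - g (a z)` is. -/
lemma weighted_dilation_mix_le (f g : BlochSpace) (n j : ℕ) (z : 𝔻) :
    (1 - ‖(z : ℂ)‖ ^ 2) * ‖f (dilationPoint n j * z) + (g z - g (dilationPoint n j * z))‖ ≤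
      (1 + 8 * (n + 2 : ℝ)⁻¹) * max ‖f‖ ‖g‖ +
        if IsCritical n z j then 2 * max ‖f‖ ‖g‖ else 0 := by
  set a := dilationPoint n j
  set η := (n + 2 : ℝ)⁻¹ with hη
  set M := max ‖f‖ ‖g‖ with hM
  have hη0 : 0 < η := by positivity
  have hfM : ‖f‖ ≤ M := le_max_left _ _
  have hgM : ‖g‖ ≤ M := le_max_right _ _
  have hM0 : 0 ≤ M := (norm_nonneg f).trans hfM
  have hw := one_sub_sq_nonneg z
  have hz : 0 < 1 - ‖(z : ℂ)‖ := sub_pos.2 z.norm_lt_one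
  have ht := dilationGap_pos n j
  have hfa : (1 - ‖(z : ℂ)‖ ^ 2) * ‖f (a * z)‖ ≤ M :=
    ((f.weighted_dilate_le a z).trans (f.weighted_le_norm _)).trans hfM
  have hga : (1 - ‖(z : ℂ)‖ ^ 2) * ‖g (a * z)‖ ≤ M :=
    ((g.weighted_dilate_le a z).trans (g.weighted_le_norm _)).trans hgM
  have hg : (1 - ‖(z : ℂ)‖ ^ 2) * ‖g z‖ ≤ M := (g.weighted_le_norm z).trans hgM
  have htri := mul_le_mul_of_nonneg_left (norm_add_le (f (a * z)) (g z - g (a * z))) hw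
  have htri' := mul_le_mul_of_nonneg_left (norm_sub_le (g z) (g (a * z))) hw
  have hηM : 0 ≤ η * M := by positivity
  by_cases hc : IsCritical n z j
  · rw [if_pos hc]
    linarith
  rw [if_neg hc, add_zero]
  rw [IsCritical, not_and_or, not_lt, not_lt] at hc
  rcases hc with hc | hc
  · have hr : 2 * (1 - ‖(z : ℂ)‖) / (1 - ‖(a : ℂ)‖) ≤ 2 * η := by
      rw [one_sub_norm_dilationPoint, div_le_iff₀ ht]
      linarith
    have h1 : ∀ h : BlochSpace, ‖h‖ ≤ M → (1 - ‖(z : ℂ)‖ ^ 2) * ‖h (a * z)‖ ≤ 2 * η * M :=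
      fun h hh => (h.weighted_dilate_le_div a z).trans
        (mul_le_mul hr hh (norm_nonneg _) (by positivity))
    linarith [h1 f hfM, h1 g hgM]
  · have hr : 8 * ‖1 - (a : ℂ)‖ / (1 - ‖(z : ℂ)‖) ≤ 8 * η := by
      rw [norm_one_sub_dilationPoint, div_le_iff₀ hz]
      linarith
    have h1 := (g.weighted_sub_dilate_le_div a z).trans
      (mul_le_mul hr hgM (norm_nonneg _) (by positivity))
    linarith

/-- The mean dilations satisfy the norm condition for M-ideals: at each point at most one of the
`n + 2` scales is critical, so that the critical one contributes `O(1 / n)` to the mean. -/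
lemma norm_meanDilation_mix_le (n : ℕ) (f g : BlochSpace) :
    ‖(meanDilation n f : BlochSpace) + (g - meanDilation n g)‖ ≤
      (1 + 10 * (n + 2 : ℝ)⁻¹) * max ‖f‖ ‖g‖ := by
  classical
  refine norm_le_of_weighted_le fun z => ?_
  have hmean : ∀ h : BlochSpace, (meanDilation n h : BlochSpace) z =
      (n + 2 : ℂ)⁻¹ * ∑ j ∈ Finset.range (n + 2), h (dilationPoint n j * z) := by
    intro h
    rw [meanDilation, smul_apply, sum_apply, Submodule.coe_smul, Submodule.coe_sum, coe_smul,
      Pi.smul_apply, coe_sum, smul_eq_mul]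
    rfl
  have hsum : ((meanDilation n f : BlochSpace) + (g - meanDilation n g)) z = (n + 2 : ℂ)⁻¹ *
      ∑ j ∈ Finset.range (n + 2),
        (f (dilationPoint n j * z) + (g z - g (dilationPoint n j * z))) := by
    rw [coe_add, Pi.add_apply, coe_sub, Pi.sub_apply, hmean, hmean, Finset.sum_add_distrib,
      Finset.sum_sub_distrib, Finset.sum_const, Finset.card_range, nsmul_eq_mul]
    have := natCast_add_two_ne_zero n
    push_cast
    field_simp
  set M := max ‖f‖ ‖g‖ with hM
  have hM0 : 0 ≤ M := (norm_nonneg f).trans (le_max_left _ _)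
  have hcard : ((Finset.range (n + 2)).filter (IsCritical n z)).card ≤ 1 := by
    rw [Finset.card_le_one]
    intro j hj k hk
    have hj' := (Finset.mem_filter.1 hj).2
    have hk' := (Finset.mem_filter.1 hk).2
    exact le_antisymm (hk'.le hj') (hj'.le hk')
  have hcard' : (((Finset.range (n + 2)).filter (IsCritical n z)).card : ℝ) ≤ 1 := by
    exact_mod_cast hcard
  have hbound : (1 - ‖(z : ℂ)‖ ^ 2) * ‖∑ j ∈ Finset.range (n + 2),
      (f (dilationPoint n j * z) + (g z - g (dilationPoint n j * z)))‖ ≤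
      (n + 2) * ((1 + 8 * (n + 2 : ℝ)⁻¹) * M) + 2 * M := by
    calc _ ≤ (1 - ‖(z : ℂ)‖ ^ 2) * ∑ j ∈ Finset.range (n + 2),
          ‖f (dilationPoint n j * z) + (g z - g (dilationPoint n j * z))‖ :=
          mul_le_mul_of_nonneg_left (norm_sum_le _ _) (one_sub_sq_nonneg z)
      _ ≤ ∑ j ∈ Finset.range (n + 2), ((1 + 8 * (n + 2 : ℝ)⁻¹) * M +
            if IsCritical n z j then 2 * M else 0) := by
          rw [Finset.mul_sum]
          exact Finset.sum_le_sum fun j _ => weighted_dilation_mix_le f g n j z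
      _ = (n + 2) * ((1 + 8 * (n + 2 : ℝ)⁻¹) * M) +
            ((Finset.range (n + 2)).filter (IsCritical n z)).card * (2 * M) := by
          rw [Finset.sum_add_distrib, Finset.sum_const, Finset.card_range, nsmul_eq_mul,
            ← Finset.sum_filter, Finset.sum_const, nsmul_eq_mul]
          push_cast
          ring
      _ ≤ _ := by
          have := mul_le_mul_of_nonneg_right hcard' (by positivity : 0 ≤ 2 * M)
          linarith
  rw [hsum, norm_mul, norm_inv_natCast_add_two, mul_left_comm, inv_mul_le_iff₀ (by positivity)]
  refine hbound.trans_eq ?_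
  field_simp
  ring

end BlochSpace

/-! ### Almost isometric embeddings into `c₀` -/

section Embedding

variable {𝕜 E : Type*} [RCLike 𝕜] [NormedAddCommGroup E] [NormedSpace 𝕜 E]

/-- The operator `x ↦ (v n x)` into `c₀` given by a pointwise null sequence of functionals of norm
at most `1`. -/
def nullSequenceMap (v : ℕ → StrongDual 𝕜 E) (hv : ∀ n x, ‖v n x‖ ≤ ‖x‖)
    (hlim : ∀ x, Tendsto (fun n => v n x) cofinite (𝓝 0)) : E →L[𝕜] C₀(ℕ, 𝕜) :=
  LinearMap.mkContinuous
    { toFun := fun x =>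
        ⟨⟨fun n => v n x, continuous_of_discreteTopology⟩, by
          rw [cocompact_eq_cofinite]
          exact hlim x⟩
      map_add' := fun x y => by
        ext n
        exact map_add (v n) x y
      map_smul' := fun c x => by
        ext n
        exact map_smul (v n) c x } 1 fun x => by
    rw [one_mul, ← ZeroAtInftyContinuousMap.norm_toBCF_eq_norm,
      BoundedContinuousFunction.norm_le (norm_nonneg x)]
    exact fun n => hv n x

lemma norm_apply_le_norm_nullSequenceMap (v : ℕ → StrongDual 𝕜 E) (hv : ∀ n x, ‖v n x‖ ≤ ‖x‖)
    (hlim : ∀ x, Tendsto (fun n => v n x) cofinite (𝓝 0)) (n : ℕ) (x : E) :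
    ‖v n x‖ ≤ ‖nullSequenceMap v hv hlim x‖ := by
  rw [← ZeroAtInftyContinuousMap.norm_toBCF_eq_norm]
  exact (nullSequenceMap v hv hlim x).toBCF.norm_coe_le_norm n

/-- The range of the operator into `c₀` is closed because it is bounded below on a complete
space. -/
lemma embedsAlmostIsometrically_of_norming [CompleteSpace E]
    (h : ∀ K : ℝ, 1 < K → ∃ v : ℕ → StrongDual 𝕜 E, (∀ n x, ‖v n x‖ ≤ ‖x‖) ∧
      (∀ x, Tendsto (fun n => v n x) cofinite (𝓝 0)) ∧
      ∀ x c, (∀ n, ‖v n x‖ ≤ c) → ‖x‖ ≤ K * c) :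
    EmbedsAlmostIsometrically 𝕜 E C₀(ℕ, 𝕜) := by
  intro ε hε
  obtain ⟨v, hv, hlim, hnorm⟩ := h (1 + ε / 2) (by linarith)
  set T := nullSequenceMap v hv hlim
  have hT : ‖T‖ ≤ 1 := LinearMap.mkContinuous_norm_le _ zero_le_one _
  have hlow : ∀ x, ‖x‖ ≤ (1 + ε / 2) * ‖T x‖ := fun x =>
    hnorm x _ fun n => norm_apply_le_norm_nullSequenceMap v hv hlim n x
  have hanti : AntilipschitzWith ⟨1 + ε / 2, by positivity⟩ T :=
    AddMonoidHomClass.antilipschitz_of_bound T hlow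
  have hclosed : IsClosed (Set.range T) := hanti.isClosed_range T.uniformContinuous
  let e := T.equivRange hanti.injective hclosed
  refine ⟨T.range, hclosed, ?_⟩
  refine iInf_lt_iff.2 ⟨e, ?_⟩
  rw [ENNReal.ofReal_lt_ofReal_iff (by linarith)]
  have he : ‖(e : E →L[𝕜] T.range)‖ ≤ 1 :=
    ContinuousLinearMap.opNorm_le_bound _ zero_le_one fun x => T.le_of_opNorm_le hT x
  have hes : ‖(e.symm : T.range →L[𝕜] E)‖ ≤ 1 + ε / 2 := by
    refine ContinuousLinearMap.opNorm_le_bound _ (by positivity) fun y => ?_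
    obtain ⟨x, rfl⟩ := e.surjective y
    have h1 : e.symm (e x) = x := e.symm_apply_apply x
    change ‖e.symm (e x)‖ ≤ _
    rw [h1]
    exact hlow x
  refine (mul_le_mul he hes (ContinuousLinearMap.opNorm_nonneg _) zero_le_one).trans_lt ?_
  linarith

end Embedding

/-! ### Sampling the little Bloch space -/

namespace BlochSpace

/-- A countable family of points of the disc, finite on each compact subset, that is `δ`-dense at
the scale `1 - |z|` of the boundary distance: finite nets of the annuli
`2^-(m+1) ≤ 1 - |z| ≤ 2^-m` at distance `δ 2^-(m+1)`. -/
lemma exists_sampling_points {δ : ℝ} (hδ : 0 < δ) :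
    ∃ (P : Type) (_ : Countable P) (u : P → 𝔻),
      (∀ s > 0, {p | s ≤ 1 - ‖(u p : ℂ)‖}.Finite) ∧
      ∀ z : 𝔻, ∃ p, ∃ r > 0, r ≤ 1 - ‖(z : ℂ)‖ ∧ 1 - ‖(z : ℂ)‖ ≤ 2 * r ∧ r ≤ 1 - ‖(u p : ℂ)‖ ∧
        ‖(z : ℂ) - u p‖ ≤ δ * r := by
  let A : ℕ → Set ℂ := fun m => {z | (1 / 2 : ℝ) ^ (m + 1) ≤ 1 - ‖z‖ ∧ 1 - ‖z‖ ≤ (1 / 2 : ℝ) ^ m}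
  have hnet : ∀ m, ∃ t ⊆ A m, t.Finite ∧ A m ⊆ ⋃ y ∈ t, Metric.ball y (δ * (1 / 2) ^ (m + 1)) := by
    intro m
    have htb : TotallyBounded (A m) := (isCompact_closedBall (0 : ℂ) 1).totallyBounded.subset
      fun z hz => mem_closedBall_zero_iff.2
        (by linarith [hz.1, pow_pos (by norm_num : (0 : ℝ) < 1 / 2) (m + 1)])
    exact Metric.finite_approx_of_totallyBounded htb _ (by positivity)
  choose t htA ht hcov using hnet
  have hlt : ∀ m, ∀ p ∈ t m, ‖p‖ < 1 := fun m p hp => by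
    linarith [(htA m hp).1, pow_pos (by norm_num : (0 : ℝ) < 1 / 2) (m + 1)]
  have hfin : ∀ m, Finite (t m) := fun m => (ht m).to_subtype
  refine ⟨Σ m, t m, inferInstance, fun p => Complex.UnitDisc.mk p.2 (hlt p.1 p.2 p.2.2), ?_, ?_⟩
  · intro s hs
    obtain ⟨N, hN⟩ := exists_pow_lt_of_lt_one hs (by norm_num : (1 / 2 : ℝ) < 1)
    refine ((Set.finite_lt_nat N).preimage' (f := Sigma.fst) fun m _ => ?_).subset fun p hp => ?_
    · have : (Sigma.fst ⁻¹' {m} : Set (Σ m, t m)) = Set.range (Sigma.mk m) :=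
        (Set.range_sigmaMk m).symm
      rw [this]
      exact Set.finite_range _
    · have h1 := (htA p.1 p.2.2).2
      have h2 : s ≤ (1 / 2 : ℝ) ^ p.1 := le_trans hp h1
      exact (pow_lt_pow_iff_right_of_lt_one₀ (by norm_num) (by norm_num)).1 (hN.trans_le h2)
  · intro z
    obtain ⟨m, hm1, hm2⟩ := exists_nat_pow_near_of_lt_one (sub_pos.2 z.norm_lt_one)
      (sub_le_self 1 (norm_nonneg (z : ℂ))) (by norm_num : (0 : ℝ) < 1 / 2) (by norm_num)
    obtain ⟨p, hp, hzp⟩ := Set.mem_iUnion₂.1 (hcov m (show (z : ℂ) ∈ A m from ⟨hm1.le, hm2⟩))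
    refine ⟨⟨m, p, hp⟩, (1 / 2) ^ (m + 1), by positivity, hm1.le, ?_, (htA m hp).1, ?_⟩
    · exact hm2.trans_eq (by ring)
    · exact (mem_ball_iff_norm.1 hzp).le

/-- The weighted modulus is almost constant at small hyperbolic distances. -/
lemma weighted_le_weighted_add (f : BlochSpace) {δ r : ℝ} (hr : 0 < r) {z w : 𝔻}
    (hrz : r ≤ 1 - ‖(z : ℂ)‖) (hzr : 1 - ‖(z : ℂ)‖ ≤ 2 * r) (hrw : r ≤ 1 - ‖(w : ℂ)‖)
    (hzw : ‖(z : ℂ) - w‖ ≤ δ * r) :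
    (1 - ‖(z : ℂ)‖ ^ 2) * ‖f z‖ ≤ (1 - ‖(w : ℂ)‖ ^ 2) * ‖f w‖ + 18 * δ * ‖f‖ := by
  have hδ : 0 ≤ δ * r := (norm_nonneg _).trans hzw
  have h1 : ‖f z - f w‖ ≤ 4 * ‖f‖ / r ^ 2 * (δ * r) := by
    have h := f.norm_sub_le_of_norm_le (ρ := 1 - r) (by linarith) (z := z) (w := w) (by linarith)
      (by linarith)
    rw [sub_sub_cancel] at h
    exact h.trans (mul_le_mul_of_nonneg_left hzw (by positivity))
  have h2 : (1 - ‖(z : ℂ)‖ ^ 2) * ‖f z - f w‖ ≤ 16 * δ * ‖f‖ := by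
    calc _ ≤ 4 * r * (4 * ‖f‖ / r ^ 2 * (δ * r)) :=
          mul_le_mul ((one_sub_sq_le z).trans (by linarith)) h1 (norm_nonneg _) (by positivity)
      _ = 16 * δ * ‖f‖ := by
          field_simp
          ring
  have h3 : (‖(w : ℂ)‖ ^ 2 - ‖(z : ℂ)‖ ^ 2) * ‖f w‖ ≤ 2 * δ * ‖f‖ := by
    have h4 : ‖(w : ℂ)‖ ^ 2 - ‖(z : ℂ)‖ ^ 2 ≤ 2 * (δ * r) := by
      have h5 : ‖(w : ℂ)‖ - ‖(z : ℂ)‖ ≤ δ * r := by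
        rw [norm_sub_rev] at hzw
        exact (norm_sub_norm_le _ _).trans hzw
      nlinarith [norm_nonneg (z : ℂ), norm_nonneg (w : ℂ), z.norm_lt_one, w.norm_lt_one]
    have h6 : r * ‖f w‖ ≤ ‖f‖ :=
      (mul_le_mul_of_nonneg_right hrw (norm_nonneg _)).trans (f.one_sub_mul_norm_le w)
    have h7 : 0 ≤ δ := nonneg_of_mul_nonneg_left hδ hr
    calc _ ≤ 2 * (δ * r) * ‖f w‖ := mul_le_mul_of_nonneg_right h4 (norm_nonneg _)
      _ = 2 * δ * (r * ‖f w‖) := by ring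
      _ ≤ 2 * δ * ‖f‖ := mul_le_mul_of_nonneg_left h6 (by positivity)
  have h8 := mul_le_mul_of_nonneg_left (norm_add_le (f z - f w) (f w)) (one_sub_sq_nonneg z)
  rw [sub_add_cancel] at h8
  linarith

/-- The functional `f ↦ (1 - |z|²) f z` on `β₀`. -/
def weightedEval (z : 𝔻) : StrongDual ℂ littleBloch :=
  ((1 - ‖(z : ℂ)‖ ^ 2 : ℝ) : ℂ) • (evalCLM z).comp littleBloch.subtypeL

lemma norm_weightedEval_apply (z : 𝔻) (f : littleBloch) :
    ‖weightedEval z f‖ = (1 - ‖(z : ℂ)‖ ^ 2) * ‖(f : BlochSpace) z‖ := by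
  rw [weightedEval, smul_apply, norm_smul, Complex.norm_real,
    Real.norm_of_nonneg (one_sub_sq_nonneg z)]
  rfl

theorem littleBloch_embedsAlmostIsometrically :
    EmbedsAlmostIsometrically ℂ littleBloch C₀(ℕ, ℂ) := by
  refine embedsAlmostIsometrically_of_norming fun K hK => ?_
  -- The Lipschitz estimate loses `18 δ ‖f‖`, so that the samples bound `(1 - 18 δ) ‖f‖ = K⁻¹ ‖f‖`.
  set δ := (1 - K⁻¹) / 18 with hδ
  have hK0 : 0 < K := by linarith
  have hδ0 : 0 < δ := by
    have := inv_lt_one_of_one_lt₀ hK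
    rw [hδ]
    linarith
  obtain ⟨P, _, u, hfin, hdense⟩ := exists_sampling_points hδ0
  obtain ⟨e, he⟩ := exists_injective_nat P
  -- The functionals are indexed by `ℕ` through `e`; the other entries are zero.
  let v : ℕ → StrongDual ℂ littleBloch := Function.extend e (fun p => weightedEval (u p)) 0
  have hv : ∀ p, v (e p) = weightedEval (u p) := fun p => he.extend_apply _ _ p
  have hcases : ∀ n, v n = 0 ∨ ∃ p, e p = n := by
    intro n
    by_cases h : ∃ p, e p = n
    · exact Or.inr h
    · exact Or.inl (Function.extend_apply' _ _ _ h)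
  refine ⟨v, fun n f => ?_, fun f => ?_, fun f c hc => ?_⟩
  · rcases hcases n with h | ⟨p, rfl⟩
    · rw [h, zero_apply, norm_zero]
      exact norm_nonneg f
    · rw [hv, norm_weightedEval_apply]
      exact weighted_le_norm _ _
  · rw [Metric.tendsto_nhds]
    intro ε hε
    obtain ⟨s, hs, hfs⟩ := mem_littleBloch_iff.1 f.2 (ε / 2) (by positivity)
    filter_upwards [((hfin s hs).image e).compl_mem_cofinite] with n hn
    rw [dist_zero_right]
    rcases hcases n with h | ⟨p, rfl⟩
    · rwa [h, zero_apply, norm_zero]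
    · rw [hv, norm_weightedEval_apply]
      refine (hfs _ (not_le.1 fun hsp => hn ⟨p, hsp, rfl⟩)).trans_lt (by linarith)
  · have h1 : ‖f‖ ≤ c + 18 * δ * ‖f‖ := norm_le_of_weighted_le (f := (f : BlochSpace)) fun z => by
      obtain ⟨p, r, hr, hrz, hzr, hrp, hzp⟩ := hdense z
      refine (weighted_le_weighted_add _ hr hrz hzr hrp hzp).trans ?_
      have := hc (e p)
      rw [hv, norm_weightedEval_apply] at this
      exact add_le_add this le_rfl
    have h2 : K⁻¹ * ‖f‖ ≤ c := by
      have : 18 * δ = 1 - K⁻¹ := by rw [hδ]; ring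
      rw [this] at h1
      linarith
    rwa [inv_mul_le_iff₀ hK0] at h2

end BlochSpace

/-! ### M-ideals of compact operators -/

lemma tendsto_ten_mul_inv_add_two :
    Tendsto (fun n : ℕ => 10 * (n + 2 : ℝ)⁻¹) atTop (𝓝 0) := by
  rw [← mul_zero (10 : ℝ)]
  exact (tendsto_inv_atTop_zero.comp
    (tendsto_atTop_add_const_right _ 2 tendsto_natCast_atTop_atTop)).const_mul 10

theorem isMIdeal_compactIntoLittleBloch (X : Type*) [NormedAddCommGroup X] [NormedSpace ℂ X] :
    IsMIdeal (𝕜 := ℂ) (E := X →L[ℂ] BlochSpace) (compactIntoLittleBloch X) :=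
  isMIdeal_compactOperator_map littleBloch.subtypeₗᵢ BlochSpace.meanDilation
    (fun n => 10 * (n + 2 : ℝ)⁻¹) (fun n => by positivity) tendsto_ten_mul_inv_add_two
    BlochSpace.isCompactOperator_meanDilation BlochSpace.tendsto_meanDilation
    BlochSpace.norm_meanDilation_mix_le

/-- The case of `isMIdeal_compactOperator_map` in which the isometric embedding is the identity of
`β₀` and the mean dilations are restricted to `β₀`. -/
theorem isMIdeal_compactOperator_littleBloch :
    IsMIdeal (𝕜 := ℂ) (E := littleBloch →L[ℂ] littleBloch)
      (compactOperator (RingHom.id ℂ) littleBloch littleBloch) := by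
  have h := isMIdeal_compactOperator_map (X := littleBloch) (LinearIsometry.id (R := ℂ))
    (fun n => (BlochSpace.meanDilation n).comp littleBloch.subtypeL)
    (fun n => 10 * (n + 2 : ℝ)⁻¹) (fun n => by positivity) tendsto_ten_mul_inv_add_two
    (fun n => (BlochSpace.isCompactOperator_meanDilation n).comp_clm _)
    BlochSpace.tendsto_meanDilation
    (fun n a b => BlochSpace.norm_meanDilation_mix_le n a b)
  convert h using 1
  exact (Submodule.map_id _).symm

end

theorem corollary5p7 :
    EmbedsAlmostIsometrically ℂ littleBloch C₀(ℕ, ℂ) ∧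
    IsMIdeal (𝕜 := ℂ) (E := littleBloch →L[ℂ] littleBloch)
      (compactOperator (RingHom.id ℂ) littleBloch littleBloch) ∧
    ∀ (X : Type*) [NormedAddCommGroup X] [NormedSpace ℂ X] [CompleteSpace X],
      IsMIdeal (𝕜 := ℂ) (E := X →L[ℂ] BlochSpace) (compactIntoLittleBloch X) :=
  ⟨BlochSpace.littleBloch_embedsAlmostIsometrically, isMIdeal_compactOperator_littleBloch,
    fun X _ _ _ => isMIdeal_compactIntoLittleBloch X⟩
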